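/- All cdgas (commutative differential graded algebras) are over $\mathbb{C}$ and non-negatively graded. Fix $1\le q\le\infty$. A cdga map is a $q$-equivalence if it induces isomorphisms in cohomology in degrees $\le q$ and a monomorphism in degree $q+1$ (for $q=\infty$: isomorphisms in all degrees); $A\simeq_q B$ means that $A$ and $B$ are connected by a zig-zag of $q$-equivalences. For a group $\Phi$, a $\Phi$-cdga is a cdga with an action of $\Phi$ by cdga maps, $A^\Phi$ is its sub-cdga of fixed elements, and $A\simeq_q B$ in $\Phi$-cdga means that $A$ and $B$ are connected by a zig-zag of $\Phi$-equivariant $q$-equivalences between $\Phi$-cdgas. A cdga $A$ is $q$-finite if $A^0=\mathbb{C}\cdot 1\neq 0$ and $\sum_{i\le q}\dim A^i<\infty$. For a space $X$, $\Omega(X)$ is Sullivan's cdga of piecewise polynomial, complex-valued forms on $X$, i.e. of compatible families of polynomial forms on the singular simplices of $X$. Let $X$ be a path-connected space with the homotopy type of a CW-complex, and let $Y\to X$ be a finite Galois cover, with $Y$ path-connected and with group of deck transformations $\Phi$; let $\Phi$ act on $\Omega(Y)$ by $\varphi\cdot\omega=(\varphi^{-1})^*\omega$. Let $A$ be a $\Phi$-cdga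 over $\mathbb{C}$. 1. Suppose $\Omega(Y)\simeq_q A$ in $\Phi$-cdga, for some $1\le q\le\infty$. Then $\Omega(X)\simeq_q A^{\Phi}$ in cdga. 2. If, moreover, $A$ is $q$-finite, then $A^{\Phi}$ is $q$-finite. -/

import Mathlib

open CategoryTheory
open scoped TensorProduct DirectSum

universe u

/-! ### Commutative differential graded algebras -/

/-- A commutative differential graded algebra (cdga) over a field `k`: a non-negatively graded
`k`-vector space with an associative, unital, graded-commutative multiplication
`A^i × A^j → A^n` (`i + j = n`), and a differential of degree `1` satisfying the graded
Leibniz rule.  -/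
structure CDGA (k : Type) [Field k] where
  /-- The component of degree `i`. -/
  obj : ℕ → Type u
  [addCommGroup : ∀ i, AddCommGroup (obj i)]
  [module : ∀ i, Module k (obj i)]
  /-- The differential. -/
  d : ∀ i, obj i →ₗ[k] obj (i + 1)
  /-- The multiplication; the proof of `i + j = n` spares casts between equal degrees. -/
  mul : ∀ {i j n : ℕ}, i + j = n → (obj i →ₗ[k] obj j →ₗ[k] obj n)
  /-- The unit. -/
  one : obj 0
  one_mul : ∀ {i : ℕ} (a : obj i), mul (Nat.zero_add i) one a = a
  mul_one : ∀ {i : ℕ} (a : obj i), mul (Nat.add_zero i) a one = a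
  mul_assoc : ∀ {i j l ij jl n : ℕ} (hij : i + j = ij) (hjl : j + l = jl) (h : ij + l = n)
    (h' : i + jl = n) (a : obj i) (b : obj j) (c : obj l),
    mul h (mul hij a b) c = mul h' a (mul hjl b c)
  mul_comm : ∀ {i j n : ℕ} (h : i + j = n) (h' : j + i = n) (a : obj i) (b : obj j),
    mul h a b = (-1 : k) ^ (i * j) • mul h' b a
  d_comp_d : ∀ (i : ℕ) (a : obj i), d (i + 1) (d i a) = 0
  leibniz : ∀ {i j n : ℕ} (h : i + j = n) (h₁ : (i + 1) + j = n + 1) (h₂ : i + (j + 1) = n + 1)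
    (a : obj i) (b : obj j),
    d n (mul h a b) = mul h₁ (d i a) b + (-1 : k) ^ i • mul h₂ a (d j b)

attribute [instance] CDGA.addCommGroup CDGA.module

namespace CDGA

variable {k : Type} [Field k]

/-- Morphisms of cdgas. -/
@[ext]
structure Hom (A B : CDGA.{u} k) where
  /-- The component of degree `i`. -/
  app : ∀ i, A.obj i →ₗ[k] B.obj i
  map_d : ∀ (i : ℕ) (a : A.obj i), app (i + 1) (A.d i a) = B.d i (app i a)
  map_one : app 0 A.one = B.one
  map_mul : ∀ {i j n : ℕ} (h : i + j = n) (a : A.obj i) (b : A.obj j),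
    app n (A.mul h a b) = B.mul h (app i a) (app j b)

/-- The identity morphism. -/
def Hom.id (A : CDGA.{u} k) : A.Hom A where
  app _ := LinearMap.id
  map_d _ _ := rfl
  map_one := rfl
  map_mul _ _ _ := rfl

/-- Composition of morphisms, `g` after `f`. -/
def Hom.comp {A B C : CDGA.{u} k} (g : B.Hom C) (f : A.Hom B) : A.Hom C where
  app i := g.app i ∘ₗ f.app i
  map_d i a := by simp [f.map_d, g.map_d]
  map_one := by simp [f.map_one, g.map_one]
  map_mul h a b := by simp [f.map_mul, g.map_mul]

/-- The cocycles `Z^i(A)`. -/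
def cocycles (A : CDGA.{u} k) (i : ℕ) : Submodule k (A.obj i) := LinearMap.ker (A.d i)

/-- The coboundaries `B^i(A)`; in degree `0` there are only trivial ones. -/
def coboundaries (A : CDGA.{u} k) : ∀ i : ℕ, Submodule k (A.obj i)
  | 0 => ⊥
  | i + 1 => LinearMap.range (A.d i)

/-- The cohomology `H^i(A) = Z^i(A) / B^i(A)`. -/
abbrev cohomology (A : CDGA.{u} k) (i : ℕ) : Type u :=
  A.cocycles i ⧸ (A.coboundaries i).submoduleOf (A.cocycles i)

theorem Hom.app_mem_cocycles {A B : CDGA.{u} k} (f : A.Hom B) (i : ℕ) (a : A.obj i)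
    (ha : a ∈ A.cocycles i) : f.app i a ∈ B.cocycles i := by
  simp only [cocycles, LinearMap.mem_ker] at ha ⊢
  rw [← f.map_d, ha, map_zero]

theorem Hom.app_mem_coboundaries {A B : CDGA.{u} k} (f : A.Hom B) (i : ℕ) (a : A.obj i)
    (ha : a ∈ A.coboundaries i) : f.app i a ∈ B.coboundaries i := by
  cases i with
  | zero =>
    simp only [coboundaries, Submodule.mem_bot] at ha ⊢
    rw [ha, map_zero]
  | succ i =>
    obtain ⟨b, rfl⟩ := ha
    exact ⟨f.app i b, (f.map_d i b).symm⟩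

/-- The map induced by a morphism of cdgas in cohomology. -/
def Hom.cohomologyMap {A B : CDGA.{u} k} (f : A.Hom B) (i : ℕ) :
    A.cohomology i →ₗ[k] B.cohomology i :=
  Submodule.mapQ _ _ ((f.app i).restrict (f.app_mem_cocycles i))
    (fun a ha => f.app_mem_coboundaries i a ha)

/-- A `q`-equivalence (`q = ∞` allowed): isomorphisms in cohomology up to degree `q`, and a
monomorphism in degree `q + 1`. -/
def Hom.IsQEquiv {A B : CDGA.{u} k} (q : ℕ∞) (f : A.Hom B) : Prop :=
  (∀ i : ℕ, (i : ℕ∞) ≤ q → Function.Bijective (f.cohomologyMap i)) ∧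
    ∀ i : ℕ, (i : ℕ∞) = q + 1 → Function.Injective (f.cohomologyMap i)

/-- `A ≃_q B`: the cdgas are connected by a zig-zag of `q`-equivalences. -/
def SameQType (q : ℕ∞) (A B : CDGA.{u} k) : Prop :=
  Relation.EqvGen (fun A B : CDGA.{u} k => ∃ f : A.Hom B, f.IsQEquiv q) A B

/-- A cdga is connected if its degree `0` part is the line spanned by the unit. -/
def IsConnected (A : CDGA.{u} k) : Prop :=
  A.one ≠ 0 ∧ Submodule.span k {A.one} = ⊤

/-- A cdga is `q`-finite (`q = ∞` allowed) if it is connected and `⨁_{i ≤ q} A^i` is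
finite-dimensional. -/
def IsQFinite (q : ℕ∞) (A : CDGA.{u} k) : Prop :=
  A.IsConnected ∧ Module.Finite k (⨁ i : {i : ℕ // (i : ℕ∞) ≤ q}, A.obj i)

end CDGA

/-! ### Equivariant cdgas -/

/-- A `Φ`-cdga: a cdga with a (left) action of the group `Φ` by cdga morphisms. -/
structure EquivariantCDGA (k : Type) [Field k] (Φ : Type*) [Group Φ] extends CDGA.{u} k where
  /-- The action. -/
  act : Φ → toCDGA.Hom toCDGA
  act_one : act 1 = CDGA.Hom.id toCDGA
  act_mul : ∀ g h : Φ, act (g * h) = (act g).comp (act h)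

namespace EquivariantCDGA

variable {k : Type} [Field k] {Φ : Type*} [Group Φ]

/-- Equivariance of a morphism between the cdgas underlying two `Φ`-cdgas. -/
def IsEquivariant (A B : EquivariantCDGA.{u} k Φ) (f : A.toCDGA.Hom B.toCDGA) : Prop :=
  ∀ g : Φ, f.comp (A.act g) = (B.act g).comp f

/-- `A ≃_q B` in the category of `Φ`-cdgas: there is a zig-zag of equivariant
`q`-equivalences. -/
def SameQType (q : ℕ∞) (A B : EquivariantCDGA.{u} k Φ) : Prop :=
  Relation.EqvGen (fun A B : EquivariantCDGA.{u} k Φ =>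
    ∃ f : A.toCDGA.Hom B.toCDGA, IsEquivariant A B f ∧ f.IsQEquiv q) A B

/-- The elements of degree `i` fixed by `Φ`. -/
def fixedSubmodule (A : EquivariantCDGA.{u} k Φ) (i : ℕ) : Submodule k (A.obj i) where
  carrier := {a | ∀ g : Φ, (A.act g).app i a = a}
  zero_mem' g := map_zero _
  add_mem' ha hb g := by rw [map_add, ha g, hb g]
  smul_mem' c a ha g := by rw [map_smul, ha g]

/-- The sub-cdga `A^Φ` of the elements fixed by `Φ`. -/
def fixedPoints (A : EquivariantCDGA.{u} k Φ) : CDGA.{u} k where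
  obj i := A.fixedSubmodule i
  d i := (A.d i).restrict fun a ha g => by rw [(A.act g).map_d, ha g]
  mul {i j n} h := LinearMap.mk₂ k
    (fun a b => ⟨A.mul h a.1 b.1, fun g => by rw [(A.act g).map_mul, a.2 g, b.2 g]⟩)
    (fun _ _ _ => Subtype.ext (by simp)) (fun _ _ _ => Subtype.ext (by simp))
    (fun _ _ _ => Subtype.ext (by simp)) (fun _ _ _ => Subtype.ext (by simp))
  one := ⟨A.one, fun g => (A.act g).map_one⟩
  one_mul a := Subtype.ext (A.one_mul a.1)
  mul_one a := Subtype.ext (A.mul_one a.1)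
  mul_assoc hij hjl h h' a b c := Subtype.ext (A.mul_assoc hij hjl h h' a.1 b.1 c.1)
  mul_comm h h' a b := Subtype.ext (A.mul_comm h h' a.1 b.1)
  d_comp_d i a := Subtype.ext (A.d_comp_d i a.1)
  leibniz h h₁ h₂ a b := Subtype.ext (A.leibniz h h₁ h₂ a.1 b.1)

end EquivariantCDGA

/-! ### Polynomial differential forms on the standard simplices -/

namespace PolyForm

variable (k : Type) [Field k]

/-- Polynomial differential forms on the standard `n`-simplex, with coefficients in `k`, in the
coordinates `t_1, …, t_n` (and `t_0 = 1 - t_1 - ⋯ - t_n`): the algebra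
`k[t_1, …, t_n] ⊗ Λ(dt_1, …, dt_n)`, which is
`Λ(t_0, …, t_n, dt_0, …, dt_n) / (∑ t_i - 1, ∑ dt_i)`. -/
abbrev Form (n : ℕ) : Type :=
  MvPolynomial (Fin n) k ⊗[k] ExteriorAlgebra k (Fin n → k)

/-- The forms of degree `p`, spanned by the products of a polynomial and a `p`-fold product
of linear combinations of `dt_1, …, dt_n`. -/
noncomputable def degree (n p : ℕ) : Submodule k (Form k n) :=
  Submodule.span k {ω | ∃ (f : MvPolynomial (Fin n) k) (a : ExteriorAlgebra k (Fin n → k)),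
    a ∈ ⋀[k]^p (Fin n → k) ∧ ω = f ⊗ₜ[k] a}

variable {k}

/-- The generator `dt_i` of the exterior algebra. -/
noncomputable def dt {n : ℕ} (i : Fin n) : ExteriorAlgebra k (Fin n → k) :=
  ExteriorAlgebra.ι k (Pi.single i 1)

variable (k) in
/-- The exterior derivative `d(f a) = ∑ i, (∂f/∂t_i) dt_i a`. -/
noncomputable def d (n : ℕ) : Form k n →ₗ[k] Form k n :=
  ∑ i : Fin n, TensorProduct.map (MvPolynomial.pderiv i).toLinearMap
    (LinearMap.mulLeft k (dt i))

/-- The barycentric coordinates `t_0, …, t_n`. -/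
noncomputable def bary {n : ℕ} : Fin (n + 1) → MvPolynomial (Fin n) k :=
  Fin.cons (1 - ∑ i, MvPolynomial.X i) MvPolynomial.X

/-- The coordinate vectors of the differentials of the barycentric coordinates,
`dt_0 = - dt_1 - ⋯ - dt_n, dt_1, …, dt_n`. -/
def dbary {n : ℕ} : Fin (n + 1) → (Fin n → k) :=
  Fin.cons (-∑ i, Pi.single i 1) (fun i => Pi.single i 1)

/-- For a map `θ : {0, …, m} → {0, …, n}`, the pullback along the induced affine map of simplices
of the polynomials: `t_i ↦ ∑_{θ(j) = i} t_j`. -/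
noncomputable def pullPoly {m n : ℕ} (θ : Fin (m + 1) → Fin (n + 1)) :
    MvPolynomial (Fin n) k →ₐ[k] MvPolynomial (Fin m) k :=
  MvPolynomial.aeval fun i => ∑ j with θ j = i.succ, bary j

/-- For a map `θ : {0, …, m} → {0, …, n}`, the pullback along the induced affine map of simplices
of the differentials: `dt_i ↦ ∑_{θ(j) = i} dt_j`. -/
noncomputable def pullDiff {m n : ℕ} (θ : Fin (m + 1) → Fin (n + 1)) :
    (Fin n → k) →ₗ[k] (Fin m → k) :=
  Fintype.linearCombination k fun i : Fin n => ∑ j with θ j = i.succ, dbary (k := k) j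

variable (k) in
/-- The pullback of polynomial forms along the affine map `Δ^m → Δ^n` induced by a map
`θ : {0, …, m} → {0, …, n}` of the vertices. -/
noncomputable def pull {m n : ℕ} (θ : Fin (m + 1) → Fin (n + 1)) : Form k n →ₐ[k] Form k m :=
  Algebra.TensorProduct.map (pullPoly θ) (ExteriorAlgebra.map (pullDiff θ))

theorem tmul_mem {n p : ℕ} (f : MvPolynomial (Fin n) k) {a : ExteriorAlgebra k (Fin n → k)}
    (ha : a ∈ ⋀[k]^p (Fin n → k)) : f ⊗ₜ[k] a ∈ degree k n p :=
  Submodule.subset_span ⟨f, a, ha, rfl⟩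

theorem one_mem (n : ℕ) : (1 : Form k n) ∈ degree k n 0 :=
  tmul_mem 1 (SetLike.GradedOne.one_mem (A := fun p => ⋀[k]^p (Fin n → k)))

theorem mul_mem {n i j p : ℕ} (h : i + j = p) {ω η : Form k n} (hω : ω ∈ degree k n i)
    (hη : η ∈ degree k n j) : ω * η ∈ degree k n p := by
  subst h
  induction hω using Submodule.span_induction with
  | mem ω hω =>
    obtain ⟨f, a, ha, rfl⟩ := hω
    induction hη using Submodule.span_induction with
    | mem η hη =>
      obtain ⟨g, b, hb, rfl⟩ := hη
      rw [Algebra.TensorProduct.tmul_mul_tmul]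
      exact tmul_mem _ (SetLike.GradedMul.mul_mem (A := fun p => ⋀[k]^p (Fin n → k)) ha hb)
    | zero => simp
    | add x y _ _ hx hy => rw [mul_add]; exact add_mem hx hy
    | smul c x _ hx => rw [mul_smul_comm]; exact Submodule.smul_mem _ _ hx
  | zero => simp
  | add x y _ _ hx hy => rw [add_mul]; exact add_mem hx hy
  | smul c x _ hx => rw [smul_mul_assoc]; exact Submodule.smul_mem _ _ hx

theorem dt_mem {n : ℕ} (i : Fin n) : (dt i : ExteriorAlgebra k (Fin n → k)) ∈
    ⋀[k]^1 (Fin n → k) := by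
  unfold ExteriorAlgebra.exteriorPower
  rw [pow_one]; exact LinearMap.mem_range_self _ _

theorem d_tmul {n : ℕ} (f : MvPolynomial (Fin n) k) (a : ExteriorAlgebra k (Fin n → k)) :
    d k n (f ⊗ₜ[k] a) = ∑ i, MvPolynomial.pderiv i f ⊗ₜ[k] (dt i * a) := by
  simp [d]

theorem d_mem {n p : ℕ} {ω : Form k n} (hω : ω ∈ degree k n p) :
    d k n ω ∈ degree k n (p + 1) := by
  induction hω using Submodule.span_induction with
  | mem ω hω =>
    obtain ⟨f, a, ha, rfl⟩ := hω
    rw [d_tmul]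
    refine Submodule.sum_mem _ fun i _ => tmul_mem _ ?_
    rw [Nat.add_comm]
    exact SetLike.GradedMul.mul_mem (A := fun p => ⋀[k]^p (Fin n → k)) (dt_mem i) ha
  | zero => simp
  | add x y _ _ hx hy => rw [map_add]; exact add_mem hx hy
  | smul c x _ hx => rw [map_smul]; exact Submodule.smul_mem _ _ hx

theorem ι_mul_ι_anticomm {M : Type*} [AddCommGroup M] [Module k M] (x y : M) :
    ExteriorAlgebra.ι k x * ExteriorAlgebra.ι k y
      = -(ExteriorAlgebra.ι k y * ExteriorAlgebra.ι k x) :=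
  eq_neg_of_add_eq_zero_left (ExteriorAlgebra.ι_add_mul_swap x y)

theorem ι_mul_comm {M : Type*} [AddCommGroup M] [Module k M] (x : M) (p : ℕ)
    (b : ExteriorAlgebra k M) (hb : b ∈ ⋀[k]^p M) :
    ExteriorAlgebra.ι k x * b = (-1 : k) ^ p • (b * ExteriorAlgebra.ι k x) := by
  induction p generalizing b with
  | zero =>
    unfold ExteriorAlgebra.exteriorPower at hb
    rw [pow_zero, Submodule.mem_one] at hb
    obtain ⟨c, rfl⟩ := hb
    simp [Algebra.commutes]
  | succ p ih =>
    unfold ExteriorAlgebra.exteriorPower at hb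
    rw [pow_succ'] at hb
    induction hb using Submodule.mul_induction_on' with
    | mem_mul_mem m hm c hc =>
      obtain ⟨y, rfl⟩ := hm
      rw [← mul_assoc, ι_mul_ι_anticomm, neg_mul, mul_assoc, ih c hc, mul_smul_comm, pow_succ,
        mul_assoc]
      simp
    | add a _ b _ ha hb => rw [mul_add, add_mul, smul_add, ha, hb]

theorem ext_mul_comm {M : Type*} [AddCommGroup M] [Module k M] (p q : ℕ)
    (a b : ExteriorAlgebra k M) (ha : a ∈ ⋀[k]^p M) (hb : b ∈ ⋀[k]^q M) :
    a * b = (-1 : k) ^ (p * q) • (b * a) := by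
  induction p generalizing a with
  | zero =>
    unfold ExteriorAlgebra.exteriorPower at ha
    rw [pow_zero, Submodule.mem_one] at ha
    obtain ⟨c, rfl⟩ := ha
    simp [Algebra.commutes]
  | succ p ih =>
    unfold ExteriorAlgebra.exteriorPower at ha
    rw [pow_succ'] at ha
    induction ha using Submodule.mul_induction_on' with
    | mem_mul_mem m hm c hc =>
      obtain ⟨y, rfl⟩ := hm
      rw [mul_assoc, ih c hc, mul_smul_comm, ← mul_assoc, ι_mul_comm y q b hb, smul_mul_assoc,
        smul_smul, ← pow_add, mul_assoc, Nat.succ_mul]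
    | add a _ b _ ha hb => rw [mul_add, add_mul, smul_add, ha, hb]

theorem mul_comm' {n i j : ℕ} {ω η : Form k n} (hω : ω ∈ degree k n i)
    (hη : η ∈ degree k n j) : ω * η = (-1 : k) ^ (i * j) • (η * ω) := by
  induction hω using Submodule.span_induction with
  | mem ω hω =>
    obtain ⟨f, a, ha, rfl⟩ := hω
    induction hη using Submodule.span_induction with
    | mem η hη =>
      obtain ⟨g, b, hb, rfl⟩ := hη
      rw [Algebra.TensorProduct.tmul_mul_tmul, Algebra.TensorProduct.tmul_mul_tmul,
        ext_mul_comm i j a b ha hb, mul_comm f g, TensorProduct.tmul_smul]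
    | zero => simp
    | add x y _ _ hx hy => rw [mul_add, add_mul, smul_add, hx, hy]
    | smul c x _ hx => rw [mul_smul_comm, smul_mul_assoc, hx, smul_comm]
  | zero => simp
  | add x y _ _ hx hy => rw [mul_add, add_mul, smul_add, hx, hy]
  | smul c x _ hx => rw [mul_smul_comm, smul_mul_assoc, hx, smul_comm]

theorem leibniz {n i : ℕ} {ω : Form k n} (hω : ω ∈ degree k n i) (η : Form k n) :
    d k n (ω * η) = d k n ω * η + (-1 : k) ^ i • (ω * d k n η) := by
  induction hω using Submodule.span_induction with
  | mem ω hω =>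
    obtain ⟨f, a, ha, rfl⟩ := hω
    induction η using TensorProduct.induction_on with
    | zero => simp
    | add x y hx hy => rw [mul_add, map_add, hx, hy, map_add, mul_add, mul_add, smul_add]; abel
    | tmul g b =>
      rw [Algebra.TensorProduct.tmul_mul_tmul, d_tmul, d_tmul, d_tmul, Finset.sum_mul,
        Finset.mul_sum, Finset.smul_sum, ← Finset.sum_add_distrib]
      refine Finset.sum_congr rfl fun l _ => ?_
      rw [Algebra.TensorProduct.tmul_mul_tmul, Algebra.TensorProduct.tmul_mul_tmul,
        Derivation.leibniz, TensorProduct.add_tmul, add_comm, ← TensorProduct.tmul_smul]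
      congr 1
      · rw [smul_eq_mul, mul_comm, mul_assoc]
      · rw [smul_eq_mul, ← mul_assoc, ← mul_assoc, dt, ι_mul_comm _ i a ha, smul_mul_assoc]
  | zero => simp
  | add x y _ _ hx hy => rw [add_mul, map_add, hx, hy, map_add, add_mul, add_mul, smul_add]; abel
  | smul c x _ hx =>
    rw [smul_mul_assoc, map_smul, hx, map_smul, smul_mul_assoc, smul_mul_assoc, smul_add,
      smul_comm c]

theorem pderiv_comm {n : ℕ} (i j : Fin n) (f : MvPolynomial (Fin n) k) :
    MvPolynomial.pderiv j (MvPolynomial.pderiv i f)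
      = MvPolynomial.pderiv i (MvPolynomial.pderiv j f) := by
  have h : ⁅MvPolynomial.pderiv (R := k) j, MvPolynomial.pderiv i⁆ = 0 :=
    MvPolynomial.derivation_ext fun l => by
      rw [Derivation.commutator_apply, MvPolynomial.pderiv_X, MvPolynomial.pderiv_X]
      by_cases hj : j = l <;> by_cases hi : i = l <;> simp [hi, hj, eq_comm]
  have h' := congrArg (fun D => D f) h
  rw [Derivation.commutator_apply] at h'
  exact sub_eq_zero.1 h'

theorem d_comp_d {n : ℕ} (ω : Form k n) : d k n (d k n ω) = 0 := by
  induction ω using TensorProduct.induction_on with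
  | zero => simp
  | add x y hx hy => rw [map_add, map_add, hx, hy, add_zero]
  | tmul f a =>
    have key : ∀ i j : Fin n,
        MvPolynomial.pderiv j (MvPolynomial.pderiv i f) ⊗ₜ[k] (dt (k := k) j * (dt i * a))
          = -(MvPolynomial.pderiv i (MvPolynomial.pderiv j f) ⊗ₜ[k]
            (dt (k := k) i * (dt j * a))) := by
      intro i j
      rw [← mul_assoc, dt, dt, ι_mul_ι_anticomm, neg_mul, TensorProduct.tmul_neg, mul_assoc,
        pderiv_comm]
    have hsq : ∀ i : Fin n, (dt (k := k) i * (dt i * a)) = 0 := by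
      intro i
      rw [← mul_assoc, dt, ExteriorAlgebra.ι_sq_zero, zero_mul]
    simp only [d_tmul, map_sum]
    rw [← Finset.sum_product']
    refine Finset.sum_involution (fun x _ => (x.2, x.1)) ?_ ?_ ?_ ?_
    · rintro ⟨i, j⟩ _
      rw [key i j, neg_add_cancel]
    · rintro ⟨i, j⟩ _ hne heq
      obtain rfl : j = i := (Prod.ext_iff.1 heq).1
      exact hne (by rw [hsq, TensorProduct.tmul_zero])
    · simp
    · simp

theorem pull_mem {m n p : ℕ} (θ : Fin (m + 1) → Fin (n + 1)) {ω : Form k n}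
    (hω : ω ∈ degree k n p) : pull k θ ω ∈ degree k m p := by
  induction hω using Submodule.span_induction with
  | mem ω hω =>
    obtain ⟨f, a, ha, rfl⟩ := hω
    rw [pull, Algebra.TensorProduct.map_tmul]
    refine tmul_mem _ ?_
    have h := Submodule.mem_map_of_mem (f := (ExteriorAlgebra.map (pullDiff θ)).toLinearMap) ha
    unfold ExteriorAlgebra.exteriorPower at h ⊢
    rw [Submodule.map_pow] at h
    have hle : (LinearMap.range (ExteriorAlgebra.ι k : (Fin n → k) →ₗ[k] _)).map
        (ExteriorAlgebra.map (pullDiff θ)).toLinearMap ≤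
          LinearMap.range (ExteriorAlgebra.ι k : (Fin m → k) →ₗ[k] _) := by
      rintro _ ⟨_, ⟨x, rfl⟩, rfl⟩
      exact ⟨pullDiff θ x, by simp⟩
    exact (show _ ≤ _ from pow_le_pow_left' hle p) h
  | zero => simp
  | add x y _ _ hx hy => rw [map_add]; exact add_mem hx hy
  | smul c x _ hx => rw [map_smul]; exact Submodule.smul_mem _ _ hx

theorem pderiv_bary {n : ℕ} (l : Fin n) (j : Fin (n + 1)) :
    MvPolynomial.pderiv l (bary j : MvPolynomial (Fin n) k) = MvPolynomial.C (dbary j l) := by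
  refine Fin.cases ?_ (fun i => ?_) j
  · simp [bary, dbary, MvPolynomial.pderiv_X, Pi.single_apply]
  · by_cases h : l = i <;> simp [bary, dbary, MvPolynomial.pderiv_X, h, eq_comm]

theorem pderiv_pullPoly {m n : ℕ} (θ : Fin (m + 1) → Fin (n + 1)) (l : Fin m)
    (f : MvPolynomial (Fin n) k) :
    MvPolynomial.pderiv l (pullPoly θ f) = ∑ i, pullDiff (k := k) θ (Pi.single i 1) l •
      pullPoly θ (MvPolynomial.pderiv i f) := by
  induction f using MvPolynomial.induction_on with
  | C c => simp [pullPoly]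
  | add f g hf hg => simp only [map_add, hf, hg, smul_add, Finset.sum_add_distrib]
  | mul_X f s hf =>
    have hX : MvPolynomial.pderiv l (pullPoly θ (MvPolynomial.X s : MvPolynomial (Fin n) k))
        = MvPolynomial.C (pullDiff (k := k) θ (Pi.single s 1) l) := by
      simp [pullPoly, pullDiff, pderiv_bary, Finset.sum_apply]
    rw [map_mul, Derivation.leibniz, hX, hf]
    simp only [Derivation.leibniz, smul_eq_mul, map_add, map_mul, smul_add,
      Finset.sum_add_distrib, MvPolynomial.pderiv_X, Finset.mul_sum]
    congr 1
    · rw [Finset.sum_eq_single s]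
      · simp [MvPolynomial.smul_eq_C_mul, mul_comm]
      · intro i _ hi
        simp [hi.symm]
      · simp
    · exact Finset.sum_congr rfl fun i _ => by rw [mul_smul_comm]

theorem pull_d {m n : ℕ} (θ : Fin (m + 1) → Fin (n + 1)) (ω : Form k n) :
    pull k θ (d k n ω) = d k m (pull k θ ω) := by
  induction ω using TensorProduct.induction_on with
  | zero => simp
  | add x y hx hy => simp only [map_add, hx, hy]
  | tmul f a =>
    have hdt : ∀ i : Fin n, ExteriorAlgebra.map (pullDiff θ) (dt (k := k) i)
        = ∑ l, pullDiff (k := k) θ (Pi.single i 1) l • dt l := by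
      intro i
      rw [dt, ExteriorAlgebra.map_apply_ι]
      generalize pullDiff (k := k) θ (Pi.single i 1) = v
      conv_lhs => rw [← Finset.univ_sum_single v]
      simp only [map_sum, dt, ← map_smul]
      refine Finset.sum_congr rfl fun l _ => ?_
      rw [← Pi.single_smul, smul_eq_mul, mul_one]
    rw [d_tmul, map_sum]
    simp only [pull, Algebra.TensorProduct.map_tmul, map_mul, hdt, d_tmul]
    simp only [pderiv_pullPoly, TensorProduct.sum_tmul, Finset.sum_mul, TensorProduct.tmul_sum]
    rw [Finset.sum_comm]
    refine Finset.sum_congr rfl fun l _ => Finset.sum_congr rfl fun i _ => ?_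
    rw [smul_mul_assoc, TensorProduct.tmul_smul, TensorProduct.smul_tmul']

end PolyForm

/-! ### Sullivan's algebra of piecewise polynomial forms -/

namespace Sullivan

/-- The `n`-simplices of a simplicial set. -/
abbrev Simplex (K : SSet.{u}) (n : ℕ) : Type u := K.obj (Opposite.op (SimplexCategory.mk n))

/-- The face or degeneracy `K_n → K_m` corresponding to a monotone map
`{0, …, m} → {0, …, n}`. -/
def Simplex.pull {K : SSet.{u}} {m n : ℕ} (θ : SimplexCategory.mk m ⟶ SimplexCategory.mk n)
    (σ : Simplex K n) : Simplex K m := K.map θ.op σ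

/-- The monotone map `{0, …, m} → {0, …, n}` underlying a morphism of the simplex category. -/
def vertexMap {m n : ℕ} (θ : SimplexCategory.mk m ⟶ SimplexCategory.mk n) :
    Fin (m + 1) → Fin (n + 1) :=
  fun i => θ.toOrderHom i

/-- The vector space `Ω^p(K)` of piecewise polynomial `p`-forms on a simplicial set `K`: families
of polynomial `p`-forms on the simplices of `K` that are compatible with all faces and
degeneracies. -/
noncomputable def forms (k : Type) [Field k] (K : SSet.{u}) (p : ℕ) :
    Submodule k (∀ n : ℕ, Simplex K n → PolyForm.Form k n) where
  carrier := {ω | (∀ (n : ℕ) (σ : Simplex K n), ω n σ ∈ PolyForm.degree k n p) ∧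
    ∀ (m n : ℕ) (θ : SimplexCategory.mk m ⟶ SimplexCategory.mk n) (σ : Simplex K n),
      ω m (σ.pull θ) = PolyForm.pull k (vertexMap θ) (ω n σ)}
  zero_mem' := ⟨fun _ _ => zero_mem _, fun _ _ _ _ => (map_zero _).symm⟩
  add_mem' hω hη := ⟨fun n σ => add_mem (hω.1 n σ) (hη.1 n σ), fun m n θ σ => by
    simp only [Pi.add_apply, hω.2 m n θ σ, hη.2 m n θ σ, map_add]⟩
  smul_mem' c ω hω := ⟨fun n σ => Submodule.smul_mem _ c (hω.1 n σ), fun m n θ σ => by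
    simp only [Pi.smul_apply, hω.2 m n θ σ, map_smul]⟩

/-- Sullivan's cdga `Ω(K)` of piecewise polynomial forms on a simplicial set `K`, with the
simplexwise operations. -/
noncomputable def cdga (k : Type) [Field k] (K : SSet.{u}) : CDGA.{u} k where
  obj p := forms k K p
  d p :=
    { toFun := fun ω => ⟨fun n σ => PolyForm.d k n (ω.1 n σ),
        fun n σ => PolyForm.d_mem (ω.2.1 n σ), fun m n θ σ => by
          beta_reduce
          rw [ω.2.2 m n θ σ, PolyForm.pull_d]⟩
      map_add' := fun _ _ => Subtype.ext (by ext; simp)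
      map_smul' := fun _ _ => Subtype.ext (by ext; simp) }
  mul {i j p} h := LinearMap.mk₂ k
    (fun ω η => ⟨fun n σ => ω.1 n σ * η.1 n σ,
      fun n σ => PolyForm.mul_mem h (ω.2.1 n σ) (η.2.1 n σ), fun m n θ σ => by
        beta_reduce
        rw [ω.2.2 m n θ σ, η.2.2 m n θ σ, map_mul]⟩)
    (fun _ _ _ => Subtype.ext (by ext; simp [add_mul]))
    (fun c ω η => Subtype.ext (by
      funext n σ
      exact smul_mul_assoc c (ω.1 n σ) (η.1 n σ)))
    (fun _ _ _ => Subtype.ext (by ext; simp [mul_add]))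
    (fun c ω η => Subtype.ext (by
      funext n σ
      exact mul_smul_comm c (ω.1 n σ) (η.1 n σ)))
  one := ⟨fun _ _ => 1, fun n _ => PolyForm.one_mem n, fun _ _ _ _ => (map_one _).symm⟩
  one_mul ω := Subtype.ext (by ext; simp)
  mul_one ω := Subtype.ext (by ext; simp)
  mul_assoc _ _ _ _ _ _ _ := Subtype.ext (by ext; simp [mul_assoc])
  mul_comm _ _ ω η := Subtype.ext (by
    funext n σ
    exact PolyForm.mul_comm' (ω.2.1 n σ) (η.2.1 n σ))
  d_comp_d _ ω := Subtype.ext (by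
    funext n σ
    exact PolyForm.d_comp_d (ω.1 n σ))
  leibniz _ _ _ ω η := Subtype.ext (by
    funext n σ
    exact PolyForm.leibniz (ω.2.1 n σ) (η.1 n σ))

/-- The pullback `f^* : Ω(L) → Ω(K)` along a simplicial map `f : K → L`. -/
noncomputable def map (k : Type) [Field k] {K L : SSet.{u}} (f : K ⟶ L) :
    (cdga k L).Hom (cdga k K) where
  app p :=
    { toFun := fun ω => ⟨fun n σ => ω.1 n (f.app _ σ), fun n σ => ω.2.1 n _, fun m n θ σ => by
        rw [← ω.2.2 m n θ]
        exact congrArg (ω.1 m) (NatTrans.naturality_apply f θ.op σ)⟩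
      map_add' := fun _ _ => rfl
      map_smul' := fun _ _ => rfl }
  map_d _ _ := rfl
  map_one := rfl
  map_mul _ _ _ := rfl

/-- Sullivan's cdga `Ω(X)` of piecewise polynomial, `k`-valued forms on a topological space `X`:
the forms on the singular simplicial set of `X`. -/
noncomputable def ofSpace (k : Type) [Field k] (X : Type u) [TopologicalSpace X] : CDGA.{u} k :=
  cdga k (TopCat.toSSet.obj (TopCat.of X))

/-- The pullback `f^* : Ω(Y) → Ω(X)` along a continuous map `f : X → Y`. -/
noncomputable def pullback (k : Type) [Field k] {X Y : Type u} [TopologicalSpace X]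
    [TopologicalSpace Y] (f : C(X, Y)) : (ofSpace k Y).Hom (ofSpace k X) :=
  map k (TopCat.toSSet.map (TopCat.ofHom f))

theorem pullback_id (k : Type) [Field k] (X : Type u) [TopologicalSpace X] :
    pullback k (ContinuousMap.id X) = CDGA.Hom.id (ofSpace k X) := by
  have h : TopCat.toSSet.map (TopCat.ofHom (ContinuousMap.id X)) = 𝟙 _ :=
    TopCat.toSSet.map_id (TopCat.of X)
  rw [pullback, h]
  rfl

theorem pullback_comp (k : Type) [Field k] {X Y Z : Type u} [TopologicalSpace X]
    [TopologicalSpace Y] [TopologicalSpace Z] (g : C(Y, Z)) (f : C(X, Y)) :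
    pullback k (g.comp f) = (pullback k f).comp (pullback k g) := by
  have h : TopCat.toSSet.map (TopCat.ofHom (g.comp f))
      = TopCat.toSSet.map (TopCat.ofHom f) ≫ TopCat.toSSet.map (TopCat.ofHom g) :=
    TopCat.toSSet.map_comp (TopCat.ofHom f) (TopCat.ofHom g)
  rw [pullback, h]
  rfl

end Sullivan

/-! ### CW-spaces and finite Galois covers -/

/-- A CW-space: a path-connected space with the homotopy type of a CW-complex. -/
def IsCWSpace (X : Type u) [TopologicalSpace X] : Prop :=
  PathConnectedSpace X ∧
    ∃ (Z : Type u) (_ : TopologicalSpace Z) (_ : T2Space Z)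
      (_ : Topology.CWComplex (Set.univ : Set Z)), Nonempty (ContinuousMap.HomotopyEquiv X Z)

/-- The group of deck transformations of a map `p : Y → X`: the self-homeomorphisms of `Y`
over `X`. -/
def deckGroup {X Y : Type u} [TopologicalSpace Y] (p : Y → X) : Subgroup (Y ≃ₜ Y) where
  carrier := {φ | ∀ y, p (φ y) = p y}
  one_mem' _ := rfl
  mul_mem' {φ ψ} hφ hψ y := (hφ (ψ y)).trans (hψ y)
  inv_mem' {φ} hφ y := by
    have h := hφ (φ⁻¹ y)
    rwa [show φ (φ⁻¹ y) = y from φ.apply_symm_apply y, eq_comm] at h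

/-- A finite Galois cover: a covering map with finite fibers and (path-)connected total space
whose deck transformations act transitively on every fiber. -/
structure IsFiniteGaloisCover {X Y : Type u} [TopologicalSpace X] [TopologicalSpace Y]
    (p : Y → X) : Prop where
  isCoveringMap : IsCoveringMap p
  surjective : Function.Surjective p
  pathConnectedSpace : PathConnectedSpace Y
  finite_fiber : ∀ x : X, (p ⁻¹' {x}).Finite
  exists_deck : ∀ y y' : Y, p y = p y' → ∃ φ ∈ deckGroup p, φ y = y'

/-- The cdga `Ω(Y)` of a space `Y` over `X` as a cdga with action of the deck group; as pullback is
contravariant, `φ` acts by `(φ⁻¹)^*`. -/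
noncomputable def Sullivan.equivariant (k : Type) [Field k] {X Y : Type u} [TopologicalSpace Y]
    (p : Y → X) : EquivariantCDGA.{u} k (deckGroup p) where
  toCDGA := Sullivan.ofSpace k Y
  act φ := Sullivan.pullback k (φ⁻¹.1 : C(Y, Y))
  act_one := by
    rw [← Sullivan.pullback_id]
    rfl
  act_mul φ ψ := by
    rw [← Sullivan.pullback_comp]
    congr 1

/-! ### Cohomology of cdgas in terms of cocycles and coboundaries. -/

namespace CDGA

variable {k : Type} [Field k] {A B : CDGA.{u} k}

/-! The proof joins a geometric fact to an algebraic one.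

Geometry: p^* is an isomorphism from Ω(X) onto Ω(Y)^Φ, already on the level of forms
(`Sullivan.pullbackFixed_bijective`). Since Δ^n is contractible, every singular simplex of X lifts
to Y; since Δ^n is connected and Φ is transitive on fibers, two lifts differ by a deck
transformation. So the simplices of X are the Φ-orbits of simplices of Y, and a compatible family of
forms on X is the same as an invariant one on Y.

Algebra: Φ is finite, so in characteristic zero averaging over Φ is a projection onto the fixed
elements that commutes with d and with equivariant maps. Hence passing to fixed elements preserves
q-equivalences (`EquivariantCDGA.isQEquiv_fixedMap`), and a zig-zag from Ω(Y) to A yields one from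
Ω(Y)^Φ to A^Φ. -/

theorem Hom.injective_cohomologyMap_iff (f : A.Hom B) (i : ℕ) :
    Function.Injective (f.cohomologyMap i) ↔
      ∀ a ∈ A.cocycles i, f.app i a ∈ B.coboundaries i → a ∈ A.coboundaries i := by
  rw [injective_iff_map_eq_zero]
  constructor
  · intro h a ha hfa
    have := h (Submodule.Quotient.mk ⟨a, ha⟩)
      ((Submodule.Quotient.mk_eq_zero _).2 (Submodule.mem_comap.2 hfa))
    exact Submodule.mem_comap.1 ((Submodule.Quotient.mk_eq_zero _).1 this)
  · intro h x
    obtain ⟨⟨a, ha⟩, rfl⟩ := Submodule.Quotient.mk_surjective _ x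
    intro hx
    refine (Submodule.Quotient.mk_eq_zero _).2 (Submodule.mem_comap.2 (h a ha ?_))
    exact (Submodule.Quotient.mk_eq_zero ((B.coboundaries i).submoduleOf (B.cocycles i))).1 hx

theorem Hom.surjective_cohomologyMap_iff (f : A.Hom B) (i : ℕ) :
    Function.Surjective (f.cohomologyMap i) ↔
      ∀ b ∈ B.cocycles i, ∃ a ∈ A.cocycles i, f.app i a - b ∈ B.coboundaries i := by
  constructor
  · intro h b hb
    obtain ⟨x, hx⟩ := h (Submodule.Quotient.mk ⟨b, hb⟩)
    obtain ⟨⟨a, ha⟩, rfl⟩ := Submodule.Quotient.mk_surjective _ x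
    exact ⟨a, ha, Submodule.mem_comap.1 ((Submodule.Quotient.eq _).1 hx)⟩
  · intro h y
    obtain ⟨⟨b, hb⟩, rfl⟩ := Submodule.Quotient.mk_surjective _ y
    obtain ⟨a, ha, hab⟩ := h b hb
    exact ⟨Submodule.Quotient.mk ⟨a, ha⟩,
      (Submodule.Quotient.eq _).2 (Submodule.mem_comap.2 hab)⟩

/-- An isomorphism of cdgas is a `q`-equivalence for all `q`. -/
theorem Hom.isQEquiv_of_bijective (f : A.Hom B) (hf : ∀ i, Function.Bijective (f.app i))
    (q : ℕ∞) : f.IsQEquiv q := by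
  have inj (i : ℕ) : Function.Injective (f.cohomologyMap i) := by
    refine (f.injective_cohomologyMap_iff i).2 fun a _ hfa => ?_
    cases i with
    -- A coboundary of degree 0 is zero by definition, so injectivity of `f.app 0` suffices here.
    | zero => exact (hf 0).1 (((Submodule.mem_bot k).1 hfa).trans (map_zero _).symm)
    | succ i =>
      obtain ⟨b, hb⟩ := hfa
      obtain ⟨c, rfl⟩ := (hf i).2 b
      exact ⟨c, (hf (i + 1)).1 ((f.map_d i c).trans hb)⟩
  have surj (i : ℕ) : Function.Surjective (f.cohomologyMap i) := by
    refine (f.surjective_cohomologyMap_iff i).2 fun b hb => ?_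
    obtain ⟨a, rfl⟩ := (hf i).2 b
    refine ⟨a, (hf (i + 1)).1 ?_, by simp⟩
    rw [f.map_d, map_zero]
    exact hb
  exact ⟨fun i _ => ⟨inj i, surj i⟩, fun i _ => inj i⟩

end CDGA

/-! ### Fixed elements and averaging over a finite group. -/

namespace EquivariantCDGA

variable {k : Type} [Field k] {Φ : Type*} [Group Φ]

/-- The inclusion of the fixed elements. -/
def fixedInclusion (A : EquivariantCDGA.{u} k Φ) : A.fixedPoints.Hom A.toCDGA where
  app i := (A.fixedSubmodule i).subtype
  map_d _ _ := rfl
  map_one := rfl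
  map_mul _ _ _ := rfl

/-- A morphism to a `Φ`-cdga with values in the fixed elements. -/
def codRestrictFixed {C : CDGA.{u} k} (A : EquivariantCDGA.{u} k Φ) (f : C.Hom A.toCDGA)
    (hf : ∀ g : Φ, (A.act g).comp f = f) : C.Hom A.fixedPoints where
  app i := (f.app i).codRestrict (A.fixedSubmodule i) fun c g =>
    LinearMap.congr_fun (congrFun (congrArg CDGA.Hom.app (hf g)) i) c
  map_d i c := Subtype.ext (f.map_d i c)
  map_one := Subtype.ext f.map_one
  map_mul h a b := Subtype.ext (f.map_mul h a b)

theorem IsEquivariant.app_act {A B : EquivariantCDGA.{u} k Φ} {f : A.toCDGA.Hom B.toCDGA}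
    (hf : IsEquivariant A B f) (g : Φ) {i : ℕ} (a : A.obj i) :
    f.app i ((A.act g).app i a) = (B.act g).app i (f.app i a) :=
  LinearMap.congr_fun (congrFun (congrArg CDGA.Hom.app (hf g)) i) a

/-- The morphism induced by an equivariant morphism between the fixed elements. -/
def fixedMap {A B : EquivariantCDGA.{u} k Φ} (f : A.toCDGA.Hom B.toCDGA)
    (hf : IsEquivariant A B f) : A.fixedPoints.Hom B.fixedPoints where
  app i := (f.app i).restrict fun a ha g => by rw [← hf.app_act, ha g]
  map_d i a := Subtype.ext (f.map_d i a.1)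
  map_one := Subtype.ext f.map_one
  map_mul h a b := Subtype.ext (f.map_mul h a.1 b.1)

section Average

variable [Fintype Φ]

/-- The average over the group of the translates of an element. -/
noncomputable def average (A : EquivariantCDGA.{u} k Φ) (i : ℕ) : A.obj i →ₗ[k] A.obj i :=
  (Fintype.card Φ : k)⁻¹ • ∑ g : Φ, (A.act g).app i

theorem average_apply (A : EquivariantCDGA.{u} k Φ) {i : ℕ} (a : A.obj i) :
    A.average i a = (Fintype.card Φ : k)⁻¹ • ∑ g : Φ, (A.act g).app i a := by
  simp [average]

theorem average_mem (A : EquivariantCDGA.{u} k Φ) {i : ℕ} (a : A.obj i) :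
    A.average i a ∈ A.fixedSubmodule i := by
  intro g
  rw [average_apply, map_smul, map_sum]
  congr 1
  -- Acting by `g` only permutes the summands, through h ↦ gh.
  refine Fintype.sum_equiv (Equiv.mulLeft g) _ _ fun h => ?_
  rw [Equiv.coe_mulLeft, A.act_mul]
  rfl

theorem average_of_mem [CharZero k] (A : EquivariantCDGA.{u} k Φ) {i : ℕ} {a : A.obj i}
    (ha : a ∈ A.fixedSubmodule i) : A.average i a = a := by
  rw [average_apply, Finset.sum_congr rfl fun g _ => ha g, Finset.sum_const, Finset.card_univ,
    ← Nat.cast_smul_eq_nsmul k, smul_smul, inv_mul_cancel₀ (by simp), one_smul]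

theorem d_average (A : EquivariantCDGA.{u} k Φ) {i : ℕ} (a : A.obj i) :
    A.d i (A.average i a) = A.average (i + 1) (A.d i a) := by
  simp only [average_apply, map_smul, map_sum, CDGA.Hom.map_d]

theorem IsEquivariant.app_average {A B : EquivariantCDGA.{u} k Φ} {f : A.toCDGA.Hom B.toCDGA}
    (hf : IsEquivariant A B f) {i : ℕ} (a : A.obj i) :
    f.app i (A.average i a) = B.average i (f.app i a) := by
  simp only [average_apply, map_smul, map_sum, hf.app_act]

end Average

theorem mem_cocycles_fixedPoints (A : EquivariantCDGA.{u} k Φ) {i : ℕ}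
    (a : A.fixedPoints.obj i) :
    a ∈ A.fixedPoints.cocycles i ↔ a.1 ∈ A.cocycles i :=
  Subtype.ext_iff

/-- If a fixed element is d b, then averaging b gives a fixed primitive of it. Thus the cohomology
of the fixed elements embeds in that of the whole cdga. -/
theorem mem_coboundaries_fixedPoints [Finite Φ] [CharZero k] (A : EquivariantCDGA.{u} k Φ)
    {i : ℕ} (a : A.fixedPoints.obj i) :
    a ∈ A.fixedPoints.coboundaries i ↔ a.1 ∈ A.coboundaries i := by
  have := Fintype.ofFinite Φ
  refine ⟨A.fixedInclusion.app_mem_coboundaries i a, fun ha => ?_⟩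
  cases i with
  | zero => exact Subtype.ext ha
  | succ i =>
    obtain ⟨b, hb⟩ := ha
    refine ⟨⟨A.average i b, A.average_mem b⟩, Subtype.ext ?_⟩
    exact (A.d_average b).trans ((congrArg _ hb).trans (A.average_of_mem a.2))

/-- For a finite group and in characteristic zero, an equivariant `q`-equivalence restricts to a
`q`-equivalence of the fixed elements. -/
theorem isQEquiv_fixedMap [Finite Φ] [CharZero k] {A B : EquivariantCDGA.{u} k Φ}
    {f : A.toCDGA.Hom B.toCDGA} (hf : IsEquivariant A B f) {q : ℕ∞} (hq : f.IsQEquiv q) :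
    (fixedMap f hf).IsQEquiv q := by
  have := Fintype.ofFinite Φ
  -- Injectivity and surjectivity are transferred separately, because in degree q + 1 only
  -- injectivity is given.
  have inj (i : ℕ) (h : Function.Injective (f.cohomologyMap i)) :
      Function.Injective ((fixedMap f hf).cohomologyMap i) := by
    rw [CDGA.Hom.injective_cohomologyMap_iff] at h ⊢
    intro a ha hfa
    rw [mem_cocycles_fixedPoints] at ha
    rw [mem_coboundaries_fixedPoints] at hfa ⊢
    exact h a.1 ha hfa
  have surj (i : ℕ) (h : Function.Surjective (f.cohomologyMap i)) :
      Function.Surjective ((fixedMap f hf).cohomologyMap i) := by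
    rw [CDGA.Hom.surjective_cohomologyMap_iff] at h ⊢
    intro b hb
    obtain ⟨a, ha, hab⟩ := h b.1 ((mem_cocycles_fixedPoints B b).1 hb)
    refine ⟨⟨A.average i a, A.average_mem a⟩, (mem_cocycles_fixedPoints A _).2 ?_,
      (mem_coboundaries_fixedPoints B _).2 ?_⟩
    · exact (A.d_average a).trans ((congrArg _ ha).trans (map_zero _))
    · have key : f.app i (A.average i a) - b.1 = B.average i (f.app i a - b.1) := by
        rw [hf.app_average, map_sub, B.average_of_mem b.2]
      change f.app i (A.average i a) - b.1 ∈ B.coboundaries i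
      rw [key, average_apply]
      exact Submodule.smul_mem _ _
        (Submodule.sum_mem _ fun g _ => (B.act g).app_mem_coboundaries i _ hab)
  exact ⟨fun i hi => ⟨inj i (hq.1 i hi).1, surj i (hq.1 i hi).2⟩, fun i hi => inj i (hq.2 i hi)⟩

theorem SameQType.fixedPoints [Finite Φ] [CharZero k] {q : ℕ∞} {A B : EquivariantCDGA.{u} k Φ}
    (h : SameQType q A B) : CDGA.SameQType q A.fixedPoints B.fixedPoints := by
  induction h with
  | rel A B h =>
    obtain ⟨f, hf, hq⟩ := h
    exact .rel _ _ ⟨fixedMap f hf, isQEquiv_fixedMap hf hq⟩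
  | refl A => exact .refl _
  | symm A B _ ih => exact .symm _ _ ih
  | trans A B C _ _ ih₁ ih₂ => exact .trans _ _ _ ih₁ ih₂

/-- The unit is fixed, so the line it spans in degree 0 survives entirely; in the other degrees the
fixed elements form a subspace. -/
theorem isQFinite_fixedPoints (A : EquivariantCDGA.{u} k Φ) {q : ℕ∞}
    (h : A.toCDGA.IsQFinite q) : A.fixedPoints.IsQFinite q := by
  obtain ⟨⟨h_one, h_span⟩, h_fin⟩ := h
  refine ⟨⟨fun h => h_one (congrArg Subtype.val h), ?_⟩, ?_⟩
  · rw [eq_top_iff]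
    intro a _
    obtain ⟨c, hc⟩ := Submodule.mem_span_singleton.1 (h_span.symm ▸ Submodule.mem_top : a.1 ∈ _)
    exact Submodule.mem_span_singleton.2 ⟨c, Subtype.ext hc⟩
  · refine Module.Finite.of_injective
      (DirectSum.lmap fun i : {i : ℕ // (i : ℕ∞) ≤ q} => (A.fixedSubmodule i).subtype)
      ?_
    exact (DirectSum.lmap_injective _).2 fun i => Subtype.val_injective

end EquivariantCDGA

/-! ### Lifting maps through finite Galois covers. -/

/-- A contraction run backwards is a homotopy from a constant map to f. The constant map lifts, so
the homotopy lifts, and its end at time 1 lifts f. -/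
theorem IsCoveringMap.exists_lift_of_contractibleSpace {X Y T : Type*} [TopologicalSpace X]
    [TopologicalSpace Y] [TopologicalSpace T] [ContractibleSpace T] {p : Y → X}
    (hp : IsCoveringMap p) (hs : Function.Surjective p) (f : C(T, X)) :
    ∃ g : C(T, Y), ∀ t, p (g t) = f t := by
  obtain ⟨t₀, ⟨F⟩⟩ := id_nullhomotopic T
  obtain ⟨y₀, hy₀⟩ := hs (f t₀)
  have H_zero (t : T) : (f.comp F.symm.toContinuousMap) (0, t)
      = p (ContinuousMap.const T y₀ t) := by
    simp [hy₀]
  let G := hp.liftHomotopy (f.comp F.symm.toContinuousMap) (ContinuousMap.const T y₀) H_zero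
  refine ⟨G.comp ((ContinuousMap.const T 1).prodMk (ContinuousMap.id T)), fun t => ?_⟩
  refine (congrFun (hp.liftHomotopy_lifts _ _ H_zero) (1, t)).trans ?_
  simp

section DeckGroup

variable {X Y : Type u} [TopologicalSpace X] [TopologicalSpace Y] {p : Y → X}

/-- A deck transformation is a lift of p through itself; as Y is connected, it is determined by its
value at one point, which lies in a finite fiber. -/
theorem IsFiniteGaloisCover.finite_deckGroup (hp : IsFiniteGaloisCover p) :
    Finite (deckGroup p) := by
  have := hp.pathConnectedSpace
  obtain ⟨y₀⟩ := this.nonempty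
  have := (hp.finite_fiber (p y₀)).to_subtype
  refine Finite.of_injective
    (fun φ : deckGroup p => (⟨φ.1 y₀, φ.2 y₀⟩ : p ⁻¹' {p y₀})) fun φ ψ h => ?_
  refine Subtype.ext (Homeomorph.ext fun y => ?_)
  refine congrFun (hp.isCoveringMap.eq_of_comp_eq φ.1.continuous ψ.1.continuous ?_ y₀
    (congrArg Subtype.val h)) y
  exact funext fun z => (φ.2 z).trans (ψ.2 z).symm

/-- Transitivity on a fiber makes the two lifts agree at one point after a deck transformation;
uniqueness of lifts on a connected space does the rest. -/
theorem IsFiniteGaloisCover.exists_deck_comp_eq (hp : IsFiniteGaloisCover p) {T : Type*}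
    [TopologicalSpace T] [PreconnectedSpace T] [Nonempty T] (f g : C(T, Y))
    (h : ∀ t, p (f t) = p (g t)) : ∃ φ ∈ deckGroup p, ∀ t, φ (f t) = g t := by
  obtain ⟨t₀⟩ := ‹Nonempty T›
  obtain ⟨φ, hφ, hφt⟩ := hp.exists_deck _ _ (h t₀)
  refine ⟨φ, hφ, congrFun (hp.isCoveringMap.eq_of_comp_eq (φ.continuous.comp f.continuous)
    g.continuous ?_ t₀ hφt)⟩
  exact funext fun t => (hφ (f t)).trans (h t)

instance (n : SimplexCategory) : ContractibleSpace (SimplexCategory.toTop.{u}.obj n) := by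
  have : ContractibleSpace (stdSimplex ℝ (Fin (n.len + 1))) :=
    (convex_stdSimplex ℝ (Fin (n.len + 1))).contractibleSpace
      Set.Nonempty.of_subtype
  exact (Homeomorph.ulift (X := stdSimplex ℝ (Fin (n.len + 1)))).contractibleSpace

end DeckGroup

/-! ### Singular simplices and forms on a finite Galois cover. -/

namespace Sullivan

variable {X Y : Type u} [TopologicalSpace X] [TopologicalSpace Y]

/-- The image of a singular simplex under a continuous map. -/
noncomputable abbrev pushSimplex (f : C(Y, X)) {n : ℕ}
    (σ : Simplex (TopCat.toSSet.obj (TopCat.of Y)) n) :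
    Simplex (TopCat.toSSet.obj (TopCat.of X)) n :=
  (TopCat.toSSet.map (TopCat.ofHom f)).app _ σ

theorem pushSimplex_pull (f : C(Y, X)) {m n : ℕ}
    (θ : SimplexCategory.mk m ⟶ SimplexCategory.mk n)
    (σ : Simplex (TopCat.toSSet.obj (TopCat.of Y)) n) :
    pushSimplex f (σ.pull θ) = (pushSimplex f σ).pull θ :=
  NatTrans.naturality_apply (TopCat.toSSet.map (TopCat.ofHom f)) θ.op σ

theorem pushSimplex_eq_iff (f : C(Y, X)) {n : ℕ}
    (σ : Simplex (TopCat.toSSet.obj (TopCat.of Y)) n)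
    (τ : Simplex (TopCat.toSSet.obj (TopCat.of X)) n) :
    pushSimplex f σ = τ ↔ ∀ t, f (σ.down.hom t) = τ.down.hom t := by
  constructor
  · rintro rfl t
    rfl
  · intro h
    exact congrArg ULift.up (TopCat.hom_ext (ContinuousMap.ext h))

variable {p : Y → X}

theorem pushSimplex_surjective (hp : IsFiniteGaloisCover p) (n : ℕ) :
    Function.Surjective (pushSimplex ⟨p, hp.isCoveringMap.continuous⟩ (n := n)) := by
  intro τ
  obtain ⟨g, hg⟩ := hp.isCoveringMap.exists_lift_of_contractibleSpace
    (T := SimplexCategory.toTop.{u}.obj (SimplexCategory.mk n)) hp.surjective τ.down.hom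
  exact ⟨ULift.up (TopCat.ofHom g), (pushSimplex_eq_iff _ _ _).2 hg⟩

/-- With `pushSimplex_surjective`, this identifies the n-simplices of X with the deck group orbits
of those of Y. -/
theorem exists_deck_pushSimplex (hp : IsFiniteGaloisCover p) {n : ℕ}
    (σ τ : Simplex (TopCat.toSSet.obj (TopCat.of Y)) n)
    (h : pushSimplex ⟨p, hp.isCoveringMap.continuous⟩ σ
      = pushSimplex ⟨p, hp.isCoveringMap.continuous⟩ τ) :
    ∃ φ : deckGroup p, pushSimplex (φ.1 : C(Y, Y)) σ = τ := by
  obtain ⟨φ, hφ, hστ⟩ := hp.exists_deck_comp_eq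
    (T := SimplexCategory.toTop.{u}.obj (SimplexCategory.mk n)) σ.down.hom τ.down.hom
    ((pushSimplex_eq_iff _ _ _).1 h)
  exact ⟨⟨φ, hφ⟩, (pushSimplex_eq_iff _ _ _).2 hστ⟩

variable (k : Type) [Field k]

theorem act_pullback (hp : Continuous p) (φ : deckGroup p) :
    ((equivariant k p).act φ).comp (pullback k ⟨p, hp⟩) = pullback k ⟨p, hp⟩ := by
  refine (pullback_comp k ⟨p, hp⟩ (φ⁻¹.1 : C(Y, Y))).symm.trans ?_
  congr 1
  exact ContinuousMap.ext (φ⁻¹).2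

/-- The map `p^* : Ω(X) → Ω(Y)^Φ` for a map `p : Y → X` with deck group `Φ`. -/
noncomputable def pullbackFixed (hp : Continuous p) :
    (ofSpace k X).Hom (equivariant k p).fixedPoints :=
  (equivariant k p).codRestrictFixed (pullback k ⟨p, hp⟩) (act_pullback k hp)

/-- For a finite Galois cover, the forms on the base are the invariant forms on the total
space. -/
theorem pullbackFixed_bijective (hp : IsFiniteGaloisCover p) (i : ℕ) :
    Function.Bijective ((pullbackFixed k hp.isCoveringMap.continuous).app i) := by
  have surj := pushSimplex_surjective hp
  constructor
  · intro ω η h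
    refine Subtype.ext (funext fun n => funext fun τ => ?_)
    obtain ⟨σ, rfl⟩ := surj n τ
    exact congrFun (congrFun (congrArg (fun α => α.1.1) h) n) σ
  · rintro ⟨ω, hω⟩
    have inv {n : ℕ} (σ τ : Simplex (TopCat.toSSet.obj (TopCat.of Y)) n)
        (h : pushSimplex ⟨p, hp.isCoveringMap.continuous⟩ σ
          = pushSimplex ⟨p, hp.isCoveringMap.continuous⟩ τ) : ω.1 n σ = ω.1 n τ := by
      obtain ⟨φ, rfl⟩ := exists_deck_pushSimplex hp σ τ h
      -- Since φ acts by pullback along its inverse, invariance under φ⁻¹ is the one that compares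
      -- the values at σ and at φ ∘ σ.
      have := congrFun (congrFun (congrArg Subtype.val (hω φ⁻¹)) n) σ
      rw [← this]
      change ω.1 n (pushSimplex ((φ⁻¹)⁻¹.1 : C(Y, Y)) σ) = _
      rw [inv_inv]
    -- The lifts are chosen arbitrarily, with no compatibility with faces and degeneracies. By `inv`
    -- this does not matter: the lift of a face and the face of the lift lie over the same simplex
    -- of X.
    choose lift h_lift using surj
    refine ⟨⟨fun n τ => ω.1 n (lift n τ), fun n τ => ω.2.1 n _, fun m n θ τ => ?_⟩, ?_⟩
    · beta_reduce
      rw [← ω.2.2 m n θ]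
      refine inv _ _ ?_
      rw [h_lift, pushSimplex_pull, h_lift]
    · exact Subtype.ext (Subtype.ext (funext fun n => funext fun σ => inv _ _ (h_lift n _)))

end Sullivan

theorem proposition2 {X Y : Type u} [TopologicalSpace X] [TopologicalSpace Y]
    (hX : IsCWSpace X) (p : Y → X) (hp : IsFiniteGaloisCover p)
    (A : EquivariantCDGA.{u} ℂ (deckGroup p)) (q : ℕ∞) (hq : 1 ≤ q)
    (h : EquivariantCDGA.SameQType q (Sullivan.equivariant ℂ p) A) :
    CDGA.SameQType q (Sullivan.ofSpace ℂ X) A.fixedPoints ∧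
      (A.toCDGA.IsQFinite q → A.fixedPoints.IsQFinite q) := by
  have := hp.finite_deckGroup
  -- The isomorphism from Ω(X) to Ω(Y)^Φ is one more link, put in front of the zig-zag of fixed
  -- elements.
  refine ⟨.trans _ _ _ (.rel _ _ ?_) h.fixedPoints, A.isQFinite_fixedPoints⟩
  exact ⟨Sullivan.pullbackFixed ℂ hp.isCoveringMap.continuous,
    CDGA.Hom.isQEquiv_of_bijective _ (Sullivan.pullbackFixed_bijective ℂ hp) q⟩
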